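/- Let $k$ be an arbitrary field, let $n\ge 0$, and let $I\subseteq k[x_0,\dots,x_n]$ be a homogeneous ideal (for the standard grading) of projective dimension $d\ge 0$, i.e. such that the quotient ring $k[x_0,\dots,x_n]/I$ has Krull dimension $d+1$. Let $$h_I(m)=\dim_k\bigl(k[x_0,\dots,x_n]/I\bigr)_m$$ be the Hilbert function of $I$. Then there is a unique polynomial $p_I\in\mathbb{Q}[t]$ with $h_I(m)=p_I(m)$ for all sufficiently large integers $m$ (the Hilbert polynomial of $I$); it has degree exactly $d$, and, writing $a_d$ for its leading coefficient, $\deg I:=d!\,a_d$ is a natural number. Moreover $$h_I(m)\ \ge\ \binom{m+d+1}{d+1}-\binom{m-\deg I+d+1}{d+1}\qquad\text{for all integers } m\ge 1,$$ where $\binom{a}{b}:=0$ whenever $a<b$, in particular for negative $a$. -/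

import Mathlib

open Polynomial

attribute [local instance] MvPolynomial.gradedAlgebra

noncomputable section

namespace HilbertBound

/-- The Hilbert function `h_I(m) = dim_k (k[x_0,…,x_n]/I)_m`. The homogeneous part of degree `m`
of the quotient is the image of the space of forms of degree `m`. -/
def hilbertFunction {k : Type*} [Field k] {n : ℕ}
    (I : Ideal (MvPolynomial (Fin (n + 1)) k)) (m : ℕ) : ℕ :=
  Module.finrank k
    ((MvPolynomial.homogeneousSubmodule (Fin (n + 1)) k m).map
      (Ideal.Quotient.mkₐ k I).toLinearMap)

/-- `I` has (projective) dimension `d ≥ 0`, i.e. `dim_krull (k[x_0,…,x_n]/I) - 1 = d`. -/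
def HasProjDim {k : Type*} [Field k] {n : ℕ}
    (I : Ideal (MvPolynomial (Fin (n + 1)) k)) (d : ℕ) : Prop :=
  ringKrullDim (MvPolynomial (Fin (n + 1)) k ⧸ I) = (d : WithBot ℕ∞) + 1

/-- `p` agrees with the Hilbert function of `I` at all large integers. There is at most
one such `p`. -/
def IsHilbertPolynomial {k : Type*} [Field k] {n : ℕ}
    (I : Ideal (MvPolynomial (Fin (n + 1)) k)) (p : ℚ[X]) : Prop :=
  ∃ m₀ : ℕ, ∀ m : ℕ, m₀ ≤ m → (hilbertFunction I m : ℚ) = p.eval (m : ℚ)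

open Classical in
/-- The Hilbert polynomial `p_I ∈ ℚ[t]` (with value `0` if there were none). -/
def hilbertPolynomial {k : Type*} [Field k] {n : ℕ}
    (I : Ideal (MvPolynomial (Fin (n + 1)) k)) : ℚ[X] :=
  if h : ∃ p : ℚ[X], IsHilbertPolynomial I p then h.choose else 0

/-- The degree `d! * a_d` of an ideal `I` of projective dimension `d ≥ 0`, where `a_d` is the
coefficient of `t^d` in the Hilbert polynomial of `I`. -/
def idealDegree {k : Type*} [Field k] {n : ℕ}
    (I : Ideal (MvPolynomial (Fin (n + 1)) k)) (d : ℕ) : ℚ :=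
  (d.factorial : ℚ) * (hilbertPolynomial I).coeff d

/-- The binomial coefficient of an integer `a` over `b`, which is `0` for negative `a`. -/
def binom (a : ℤ) (b : ℕ) : ℤ :=
  if 0 ≤ a then (a.toNat.choose b : ℤ) else 0

end HilbertBound

end

/-! Fix a monomial order. The standard exponents of `I` form a lower set `S`, and their monomials
are a `k`-basis of the quotient, degree by degree, so `h_I(m)` counts the points of `S` of degree
`m`. By Dickson's lemma `S` is a finite disjoint union of coordinate cones, the fibres of truncation
at a large `c`. A cone with `D + 1` free directions is counted by a binomial polynomial of degree
`D`. Hence `h_I` is eventually polynomial, and `d! a_d` is the number `δ` of cones of top dimension,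
once that dimension is known to be the Krull dimension `d + 1`. This is `sup_card_topFace_eq`, which
compares growth rates through Noether normalization.

For the bound, reset the free coordinates of each top vertex to `0`. The enlarged cones `a_j +
ℕ^(Z_j)` stay in `S` but may overlap. Ordered by `deg a_j`, they satisfy `deg a_j ≤ #{i < j : Z_i =
Z_j}`, since `S` is a lower set. For each `i < j` with `Z_i ≠ Z_j`, move the `j`-th vertex one step
in a direction of `Z_j \ Z_i`. The cones become disjoint, and the `j`-th vertex has degree at most
`j`. So the `j`-th cone has at least `C(m - j + d, d)` points in degree `m ≥ j`, and Pascal's rule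
sums these to the stated difference. -/

namespace HilbertBound

/-! ### Lower sets of exponents and their decomposition into cones -/

section LowerSets

open Finset

variable {σ : Type*}

/-- The translate `g + ℕ^Z` of a coordinate cone. -/
def cone (g : σ →₀ ℕ) (Z : Finset σ) : Set (σ →₀ ℕ) :=
  {u | g ≤ u ∧ ∀ i ∉ Z, u i = g i}

/-- The number of elements of degree `m` of a set of exponents. -/
noncomputable def levelCard (S : Set (σ →₀ ℕ)) (m : ℕ) : ℕ :=
  {u | u ∈ S ∧ u.degree = m}.ncard

/-- Truncation of all exponents at `c`. -/
noncomputable def trunc (c : ℕ) (u : σ →₀ ℕ) : σ →₀ ℕ :=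
  u.mapRange (fun x => min x c) (Nat.zero_min c)

@[simp] lemma trunc_apply (c : ℕ) (u : σ →₀ ℕ) (i : σ) : trunc c u i = min (u i) c := by
  simp [trunc]

lemma trunc_le (c : ℕ) (u : σ →₀ ℕ) : trunc c u ≤ u := fun i => by simp

lemma finite_setOf_degree_eq [Finite σ] (m : ℕ) : {u : σ →₀ ℕ | u.degree = m}.Finite := by
  classical
  have := Fintype.ofFinite σ
  refine ((univ : Finset σ).finsuppAntidiag m).finite_toSet.subset fun u hu => ?_
  simp only [mem_coe, Set.mem_ofPred_eq] at hu ⊢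
  simpa [Finsupp.degree_eq_sum] using hu

lemma finite_setOf_degree_le [Finite σ] (m : ℕ) : {u : σ →₀ ℕ | u.degree ≤ m}.Finite := by
  have : {u : σ →₀ ℕ | u.degree ≤ m} = ⋃ j ∈ Set.Iic m, {u | u.degree = j} := by
    ext u; simp
  rw [this]
  exact (Set.finite_Iic m).biUnion fun j _ => finite_setOf_degree_eq j

lemma apply_le_degree (u : σ →₀ ℕ) (i : σ) : u i ≤ u.degree := Finsupp.le_degree i u

/-- **Dickson's lemma**: membership in a lower set only depends on truncated exponents. -/
lemma exists_mem_iff_trunc_mem [Finite σ] {S : Set (σ →₀ ℕ)} (hS : IsLowerSet S) :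
    ∃ c, ∀ u, u ∈ S ↔ trunc c u ∈ S := by
  have hfin : {g | Minimal (· ∈ Sᶜ) g}.Finite :=
    WellQuasiOrderedLE.finite_of_isAntichain (setOfPred_minimal_antichain _)
  -- `c` bounds the degrees, hence the entries, of the minimal non-members, so such a `g ≤ u` also
  -- lies below `trunc c u`.
  refine ⟨hfin.toFinset.sup Finsupp.degree, fun u => ⟨fun h => hS (trunc_le _ u) h, fun h => ?_⟩⟩
  by_contra hu
  obtain ⟨g, hgu, hg⟩ := (Set.isPWO_of_wellQuasiOrderedLE Sᶜ).exists_le_minimal hu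
  refine hg.prop (hS (fun i => ?_) h)
  rw [trunc_apply]
  refine le_min (hgu i) ((apply_le_degree g i).trans ?_)
  exact Finset.le_sup (f := Finsupp.degree) (by simpa using hg)

lemma cone_level_eq_image (g : σ →₀ ℕ) (Z : Finset σ) [DecidableEq σ] {m : ℕ} (hm : g.degree ≤ m) :
    {u | u ∈ cone g Z ∧ u.degree = m} = (g + ·) '' (Z.finsuppAntidiag (m - g.degree) : Set _) := by
  ext u
  simp only [Set.mem_ofPred_eq, Set.mem_image, mem_coe, mem_finsuppAntidiag']
  constructor
  · rintro ⟨⟨hgu, hu⟩, rfl⟩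
    refine ⟨u - g, ⟨?_, ?_⟩, add_tsub_cancel_of_le hgu⟩
    · have := congrArg Finsupp.degree (add_tsub_cancel_of_le hgu)
      rw [map_add] at this
      change (u - g).degree = _
      omega
    · intro i hi
      by_contra hiZ
      simp [hu i hiZ] at hi
  · rintro ⟨w, ⟨hw, hZ⟩, rfl⟩
    refine ⟨⟨le_self_add, fun i hi => ?_⟩, ?_⟩
    · have : w i = 0 := by
        by_contra h
        exact hi (hZ (by simpa using h))
      simp [this]
    · change w.degree = _ at hw
      rw [map_add]
      omega

lemma levelCard_cone (g : σ →₀ ℕ) (Z : Finset σ) {m : ℕ} (hm : g.degree ≤ m) :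
    levelCard (cone g Z) m = (#Z + (m - g.degree) - 1).choose (m - g.degree) := by
  classical
  rw [levelCard, cone_level_eq_image g Z hm,
    Set.ncard_image_of_injective _ (add_right_injective g), Set.ncard_coe_finset,
    card_finsuppAntidiag_nat_eq_choose]

lemma levelCard_cone_of_card_eq_succ (g : σ →₀ ℕ) {Z : Finset σ} {D : ℕ} (hZ : #Z = D + 1)
    {m : ℕ} (hm : g.degree ≤ m) :
    levelCard (cone g Z) m = (m - g.degree + D).choose D := by
  rw [levelCard_cone g Z hm, hZ, ← Nat.choose_symm_add]
  congr 1
  omega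

/-- The cone is its vertex alone, hence the strict inequality. -/
lemma levelCard_cone_empty (g : σ →₀ ℕ) {m : ℕ} (hm : g.degree < m) :
    levelCard (cone g ∅) m = 0 := by
  rw [levelCard_cone g ∅ hm.le]
  exact Nat.choose_eq_zero_of_lt (by simp; omega)

lemma exists_le_degree_eq (a : σ →₀ ℕ) {t : ℕ} (ht : t ≤ a.degree) :
    ∃ b ≤ a, b.degree = t := by
  induction h : a.degree - t generalizing t with
  | zero => exact ⟨a, le_rfl, by omega⟩
  | succ s ih =>
    obtain ⟨b, hb, hbt⟩ := ih (t := t + 1) (by omega) (by omega)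
    have hb0 : b ≠ 0 := by rintro rfl; simp at hbt
    obtain ⟨i, hi⟩ := Finsupp.ne_iff.1 hb0
    have hle : Finsupp.single i 1 ≤ b := by
      rw [Finsupp.single_le_iff]
      exact Nat.one_le_iff_ne_zero.2 hi
    refine ⟨b - Finsupp.single i 1, tsub_le_self.trans hb, ?_⟩
    have := congrArg Finsupp.degree (tsub_add_cancel_of_le hle)
    rw [map_add, Finsupp.degree_single] at this
    omega

section Decomposition

variable [Fintype σ] {S : Set (σ →₀ ℕ)} {c : ℕ}

/-- The directions in which the exponent `v` has reached the bound `c`. -/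
def topFace (c : ℕ) (v : σ →₀ ℕ) : Finset σ := univ.filter fun i => v i = c

@[simp] lemma mem_topFace {v : σ →₀ ℕ} {i : σ} : i ∈ topFace c v ↔ v i = c := by simp [topFace]

lemma finite_box (S : Set (σ →₀ ℕ)) (c : ℕ) : {v | v ∈ S ∧ ∀ i, v i ≤ c}.Finite := by
  classical
  refine (Set.finite_Iic (Finsupp.equivFunOnFinite.symm fun _ : σ => c)).subset ?_
  rintro v ⟨-, hv⟩ i
  simpa using hv i

/-- The elements of `S` with all exponents at most `c`. -/
noncomputable def box (S : Set (σ →₀ ℕ)) (c : ℕ) : Finset (σ →₀ ℕ) := (finite_box S c).toFinset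

@[simp] lemma mem_box {v : σ →₀ ℕ} : v ∈ box S c ↔ v ∈ S ∧ ∀ i, v i ≤ c := by simp [box]

/-- The cones are fibres of a map; this makes the decomposition of `S` disjoint. -/
lemma mem_cone_topFace_iff {v : σ →₀ ℕ} (hv : ∀ i, v i ≤ c) (u : σ →₀ ℕ) :
    u ∈ cone v (topFace c v) ↔ trunc c u = v := by
  constructor
  · rintro ⟨hvu, hu⟩
    ext i
    rw [trunc_apply]
    by_cases hi : v i = c
    · have := hvu i
      omega
    · rw [hu i (by simpa using hi)]
      exact min_eq_left (hv i)
  · rintro rfl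
    refine ⟨trunc_le c u, fun i hi => ?_⟩
    simp only [mem_topFace, trunc_apply] at hi ⊢
    omega

/-- The predicate `p` is later both `degree = m` (Hilbert function) and `degree ≤ M` (growth). -/
lemma ncard_eq_sum_cone (hc : ∀ u, u ∈ S ↔ trunc c u ∈ S) (p : (σ →₀ ℕ) → Prop)
    (hp : {u | p u}.Finite) :
    {u | u ∈ S ∧ p u}.ncard =
      ∑ v ∈ box S c, {u | u ∈ cone v (topFace c v) ∧ p u}.ncard := by
  classical
  have hfin : {u | u ∈ S ∧ p u}.Finite := hp.subset fun u hu => hu.2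
  rw [Set.ncard_eq_toFinset_card _ hfin,
    card_eq_sum_card_fiberwise (f := trunc c) (t := box S c)]
  · refine sum_congr rfl fun v hv => ?_
    rw [← Set.ncard_coe_finset]
    congr 1
    ext u
    rw [mem_box] at hv
    simp only [coe_filter, Set.Finite.mem_toFinset, Set.mem_ofPred_eq, mem_cone_topFace_iff hv.2]
    constructor
    · tauto
    · rintro ⟨h, h'⟩
      exact ⟨⟨(hc u).2 (h ▸ hv.1), h'⟩, h⟩
  · intro u hu
    simp only [Set.Finite.coe_toFinset, Set.mem_ofPred_eq] at hu
    simp only [mem_coe, mem_box, trunc_apply, min_le_iff, le_refl, or_true,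
      implies_true, and_true]
    exact (hc u).1 hu.1

lemma levelCard_eq_sum_cone (hc : ∀ u, u ∈ S ↔ trunc c u ∈ S) (m : ℕ) :
    levelCard S m = ∑ v ∈ box S c, levelCard (cone v (topFace c v)) m :=
  ncard_eq_sum_cone hc _ (finite_setOf_degree_eq m)

/-- The level cardinalities of a lower set are eventually given by a polynomial, whose top
coefficient counts the cones of maximal dimension. -/
lemma exists_polynomial_eq_levelCard (hc : ∀ u, u ∈ S ↔ trunc c u ∈ S) {D : ℕ}
    (hD : ∀ v ∈ box S c, #(topFace c v) ≤ D + 1) :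
    ∃ p : ℚ[X], (∃ m₀, ∀ m, m₀ ≤ m → (levelCard S m : ℚ) = p.eval (m : ℚ)) ∧
      p.natDegree ≤ D ∧
      p.coeff D = #((box S c).filter fun v => #(topFace c v) = D + 1) * (D.factorial : ℚ)⁻¹ := by
  -- A cone with empty face is one point, invisible in large degrees. It gets `0` because the
  -- truncated `#(topFace c v) - 1` would give the constant `1`.
  let q : (σ →₀ ℕ) → ℚ[X] := fun v =>
    if #(topFace c v) = 0 then 0 else preHilbertPoly ℚ (#(topFace c v) - 1) v.degree
  have hq : ∀ v ∈ box S c, (q v).natDegree ≤ D := by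
    intro v hv
    have := hD v hv
    by_cases h : #(topFace c v) = 0
    · simp only [q, h, if_true, natDegree_zero, zero_le]
    · simp only [q, h, if_false, natDegree_preHilbertPoly]
      omega
  refine ⟨∑ v ∈ box S c, q v, ⟨(box S c).sup Finsupp.degree + 1, fun m hm => ?_⟩,
    natDegree_sum_le_of_forall_le _ _ hq, ?_⟩
  · rw [levelCard_eq_sum_cone hc, eval_finsetSum, Nat.cast_sum]
    refine sum_congr rfl fun v hv => ?_
    have hvm : v.degree < m := lt_of_le_of_lt (Finset.le_sup (f := Finsupp.degree) hv) hm
    by_cases h : #(topFace c v) = 0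
    · simp only [q, h, if_true, eval_zero]
      rw [card_eq_zero.1 h, levelCard_cone_empty v hvm, Nat.cast_zero]
    · simp only [q, h, if_false]
      rw [preHilbertPoly_eq_choose_sub_add _ _ hvm.le,
        levelCard_cone_of_card_eq_succ v (Nat.succ_pred_eq_of_ne_zero h).symm hvm.le]
      rfl
  · rw [finsetSum_coeff, card_filter, Nat.cast_sum, sum_mul]
    refine sum_congr rfl fun v hv => ?_
    have := hD v hv
    by_cases h : #(topFace c v) = D + 1
    · simp only [q, h, if_true, Nat.add_one_ne_zero, if_false, Nat.add_sub_cancel,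
        coeff_preHilbertPoly_self, Nat.cast_one, one_mul]
    · simp only [h, if_false, Nat.cast_zero, zero_mul]
      by_cases h0 : #(topFace c v) = 0
      · simp only [q, h0, if_true, coeff_zero]
      · simp only [q, h0, if_false]
        refine coeff_eq_zero_of_natDegree_lt ?_
        rw [natDegree_preHilbertPoly]
        omega

variable [DecidableEq σ]

/-- Truncating any point of the enlarged cone gives something below `v`. -/
lemma cone_filter_subset (hS : IsLowerSet S) (hc : ∀ u, u ∈ S ↔ trunc c u ∈ S) {v : σ →₀ ℕ}
    (hv : v ∈ S) : cone (v.filter (· ∉ topFace c v)) (topFace c v) ⊆ S := by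
  rintro u ⟨-, hu⟩
  rw [hc]
  refine hS (fun i => ?_) hv
  rw [trunc_apply]
  by_cases hi : i ∈ topFace c v
  · exact (min_le_right _ _).trans_eq (mem_topFace.1 hi).symm
  · rw [hu i hi, Finsupp.filter_apply_pos (· ∉ topFace c v) v hi]
    exact min_le_left _ _

/-- Below `v ∈ box S c` there are elements with the same top face and any smaller degree outside
of it. -/
lemma exists_mem_box_degree_eq (hS : IsLowerSet S) {v : σ →₀ ℕ} (hv : v ∈ box S c) {t : ℕ}
    (ht : t ≤ (v.filter (· ∉ topFace c v)).degree) :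
    ∃ w ∈ box S c, topFace c w = topFace c v ∧
      (w.filter (· ∉ topFace c w)).degree = t := by
  obtain ⟨b, hb, rfl⟩ := exists_le_degree_eq _ ht
  have hb0 : ∀ i ∈ topFace c v, b i = 0 := fun i hi => by
    have := hb i
    rwa [Finsupp.filter_apply_neg (· ∉ topFace c v) v (by simpa using hi), Nat.le_zero] at this
  have hb1 : ∀ i ∉ topFace c v, b i ≤ v i := fun i hi => by
    have := hb i
    rwa [Finsupp.filter_apply_pos (· ∉ topFace c v) v hi] at this
  -- The witness is `b` off the top face and `v` on it. Off the face its entries stay below `c`, so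
  -- the face does not grow.
  have hw1 : ∀ i ∈ topFace c v, (b + v.filter (· ∈ topFace c v)) i = v i := fun i hi => by
    rw [Finsupp.add_apply, hb0 i hi, Finsupp.filter_apply_pos (· ∈ topFace c v) v hi, zero_add]
  have hw2 : ∀ i ∉ topFace c v, (b + v.filter (· ∈ topFace c v)) i = b i := fun i hi => by
    rw [Finsupp.add_apply, Finsupp.filter_apply_neg (· ∈ topFace c v) v hi, add_zero]
  have hle : b + v.filter (· ∈ topFace c v) ≤ v := fun i => by
    by_cases hi : i ∈ topFace c v
    · exact (hw1 i hi).le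
    · exact (hw2 i hi).trans_le (hb1 i hi)
  rw [mem_box] at hv
  have hface : topFace c (b + v.filter (· ∈ topFace c v)) = topFace c v := by
    ext i
    by_cases hi : i ∈ topFace c v
    · simp only [hi, iff_true]
      rw [mem_topFace, hw1 i hi]
      exact mem_topFace.1 hi
    · simp only [hi, iff_false]
      rw [mem_topFace, hw2 i hi]
      have h1 := hb1 i hi
      have h2 := hv.2 i
      rw [mem_topFace] at hi
      omega
  refine ⟨_, mem_box.2 ⟨hS hle hv.1, fun i => (hle i).trans (hv.2 i)⟩, hface, ?_⟩
  rw [hface]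
  congr 1
  ext i
  by_cases hi : i ∈ topFace c v
  · rw [Finsupp.filter_apply_neg (· ∉ topFace c v) _ (by simpa using hi), hb0 i hi]
  · rw [Finsupp.filter_apply_pos (· ∉ topFace c v) _ hi, hw2 i hi]

end Decomposition

end LowerSets

end HilbertBound

namespace HilbertBound

/-! ### Making the top-dimensional cones disjoint -/

section DisjointCones

open Finset

variable {σ : Type*} [Fintype σ] [DecidableEq σ]

lemma sum_levelCard_le {ι : Type*} [Fintype ι] {S : Set (σ →₀ ℕ)} (C : ι → Set (σ →₀ ℕ))
    (hC : ∀ i, C i ⊆ S) (hdisj : Pairwise fun i j => Disjoint (C i) (C j)) (m : ℕ) :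
    ∑ i, levelCard (C i) m ≤ levelCard S m := by
  classical
  have hfin : ∀ T : Set (σ →₀ ℕ), {u | u ∈ T ∧ u.degree = m}.Finite := fun T =>
    (finite_setOf_degree_eq m).subset fun u hu => hu.2
  simp only [levelCard, Set.ncard_eq_toFinset_card _ (hfin _)]
  rw [← card_biUnion]
  · refine card_le_card fun u hu => ?_
    simp only [mem_biUnion, mem_univ, true_and, Set.Finite.mem_toFinset, Set.mem_ofPred_eq] at hu ⊢
    obtain ⟨i, hi, hm⟩ := hu
    exact ⟨hC i hi, hm⟩
  · intro i _ j _ hij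
    rw [Function.onFun, Finset.disjoint_left]
    intro u hu hu'
    simp only [Set.Finite.mem_toFinset, Set.mem_ofPred_eq] at hu hu'
    exact Set.disjoint_left.1 (hdisj hij) hu.1 hu'.1

/-- Cones `a j + ℕ^(Z j)` inside `S` can be shrunk to disjoint ones without moving the vertex of
the `j`-th one beyond degree `j`. -/
lemma sum_choose_le_levelCard {S : Set (σ →₀ ℕ)} {δ D : ℕ} (a : Fin δ → σ →₀ ℕ)
    (Z : Fin δ → Finset σ) (ha : ∀ j, ∀ i ∈ Z j, a j i = 0) (hS : ∀ j, cone (a j) (Z j) ⊆ S)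
    (hZ : ∀ j, #(Z j) = D + 1) (hinj : ∀ i j, Z i = Z j → a i = a j → i = j)
    (hdeg : ∀ j, (a j).degree ≤ #(univ.filter fun i => i < j ∧ Z i = Z j)) (m : ℕ) :
    ∑ j ∈ range δ, (if j ≤ m then (m - j + D).choose D else 0) ≤ levelCard S m := by
  -- `w X Y` is a direction in `Y \ X`, which exists for distinct sets of equal size. Its choice
  -- depends only on the two faces, so shifts from all cones with the same face accumulate in one
  -- coordinate.
  have hw : ∀ X Y : Finset σ, ∃ w : Option σ, #X = #Y → X ≠ Y → ∃ v ∈ Y, v ∉ X ∧ w = some v := by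
    intro X Y
    by_cases h : #X = #Y ∧ X ≠ Y
    · have hYX : ¬ Y ⊆ X := fun hle => h.2 (eq_of_subset_of_card_le hle h.1.le).symm
      obtain ⟨v, hv, hv'⟩ := not_subset.1 hYX
      exact ⟨some v, fun _ _ => ⟨v, hv, hv', rfl⟩⟩
    · exact ⟨none, fun h1 h2 => absurd ⟨h1, h2⟩ h⟩
  choose w hw using hw
  let e : Option σ → σ →₀ ℕ := fun o => o.elim 0 fun v => Finsupp.single v 1
  have he : ∀ o, (e o).degree ≤ 1 := by rintro (_ | v) <;> simp [e]
  let g : Fin δ → σ →₀ ℕ := fun j =>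
    a j + ∑ i ∈ univ.filter (fun i => i < j ∧ Z i ≠ Z j), e (w (Z i) (Z j))
  have hgv : ∀ j v, g j v =
      a j v + ∑ i ∈ univ.filter (fun i => i < j ∧ Z i ≠ Z j), e (w (Z i) (Z j)) v := fun j v => by
    rw [← Finsupp.finsetSum_apply]
    rfl
  have hg0 : ∀ j, ∀ v ∉ Z j, g j v = a j v := by
    intro j v hv
    rw [hgv, Nat.add_eq_left]
    refine sum_eq_zero fun i hi => ?_
    obtain ⟨v', hv', -, h⟩ := hw (Z i) (Z j) ((hZ i).trans (hZ j).symm) (mem_filter.1 hi).2.2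
    rw [h]
    exact Finsupp.single_eq_of_ne (by rintro rfl; exact hv hv')
  have hgdeg : ∀ j : Fin δ, (g j).degree ≤ j := by
    intro j
    have h1 : (∑ i ∈ univ.filter (fun i => i < j ∧ Z i ≠ Z j), e (w (Z i) (Z j))).degree ≤
        #(univ.filter fun i => i < j ∧ Z i ≠ Z j) := by
      rw [map_sum, card_eq_sum_ones]
      exact sum_le_sum fun i _ => he _
    have h2 : #(univ.filter fun i => i < j ∧ Z i = Z j) +
        #(univ.filter fun i => i < j ∧ Z i ≠ Z j) = j := by
      rw [← filter_filter, ← filter_filter (fun i => i < j) (fun i => Z i ≠ Z j),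
        card_filter_add_card_filter_not,
        filter_gt_eq_Iio, Fin.card_Iio]
    have h3 := hdeg j
    simp only [g, map_add]
    omega
  have hdisj : ∀ i j, i < j → Disjoint (cone (g i) (Z i)) (cone (g j) (Z j)) := by
    intro i j hij
    rw [Set.disjoint_left]
    rintro u ⟨-, hui⟩ ⟨hgu, huj⟩
    by_cases hZij : Z i = Z j
    · refine hij.ne (hinj i j hZij ?_)
      ext v
      by_cases hv : v ∈ Z j
      · rw [ha j v hv, ha i v (hZij ▸ hv)]
      · rw [← hg0 j v hv, ← huj v hv, ← hg0 i v (hZij ▸ hv), ← hui v (hZij ▸ hv)]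
    -- In the coordinate `v ∈ Z j \ Z i`, the `i`-th cone is frozen at height at most the number of
    -- earlier cones with face `Z i`. The `j`-th vertex was raised once for each such cone before
    -- `j`, including `i` itself.
    · obtain ⟨v, hv, hv', h⟩ := hw (Z i) (Z j) ((hZ i).trans (hZ j).symm) hZij
      have h1 : u v ≤ #(univ.filter fun i' => i' < i ∧ Z i' = Z i) := by
        rw [hui v hv', hg0 i v hv']
        exact (apply_le_degree _ _).trans (hdeg i)
      have h2 : #(univ.filter fun i' => i' < i ∧ Z i' = Z i) <
          #(univ.filter fun i' => i' < j ∧ Z i' = Z i) := by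
        refine card_lt_card (ssubset_iff_of_subset ?_ |>.2 ⟨i, by simpa using hij, by simp⟩)
        intro i' hi'
        simp only [mem_filter, mem_univ, true_and] at hi' ⊢
        exact ⟨hi'.1.trans hij, hi'.2⟩
      have h3 : #(univ.filter fun i' => i' < j ∧ Z i' = Z i) ≤ g j v := by
        rw [hgv]
        refine le_add_left ?_
        rw [card_eq_sum_ones]
        refine (sum_le_sum (g := fun i' => e (w (Z i') (Z j)) v) fun i' hi' => ?_).trans
          (sum_le_sum_of_subset fun i' hi' => ?_)
        · rw [(mem_filter.1 hi').2.2, h]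
          simp [e]
        · simp only [mem_filter, mem_univ, true_and] at hi' ⊢
          exact ⟨hi'.1, hi'.2 ▸ hZij⟩
      have h4 := hgu v
      omega
  have hsub : ∀ j, cone (g j) (Z j) ⊆ S := by
    rintro j u ⟨hgu, hu⟩
    refine hS j ⟨le_trans le_self_add hgu, fun v hv => ?_⟩
    rw [hu v hv, hg0 j v hv]
  refine le_trans ?_ (sum_levelCard_le _ hsub (fun i j hij => ?_) m)
  · rw [← Fin.sum_univ_eq_sum_range fun j => if j ≤ m then (m - j + D).choose D else 0]
    refine sum_le_sum fun j _ => ?_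
    split_ifs with hj
    · rw [levelCard_cone_of_card_eq_succ _ (hZ j) ((hgdeg j).trans hj)]
      have := hgdeg j
      exact Nat.choose_le_choose _ (by omega)
    · exact Nat.zero_le _
  · rcases lt_or_gt_of_ne hij with h | h
    · exact hdisj i j h
    · exact (hdisj j i h).symm

lemma exists_monotone_enumeration {α : Type*} (T : Finset α) (f : α → ℕ) :
    ∃ e : Fin #T ≃ T, Monotone fun i => f (e i) :=
  ⟨(Tuple.sort fun i => f (T.equivFin.symm i)).trans T.equivFin.symm,
    Tuple.monotone_sort fun i => f (T.equivFin.symm i)⟩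

/-- A lower set containing `δ` translated cones of dimension `D + 1` has at least as many elements
in each degree as there are monomials modulo a form of degree `δ` in `D + 2` variables. -/
lemma sum_choose_le_levelCard_of_isLowerSet {S : Set (σ →₀ ℕ)} {c D : ℕ} (hS : IsLowerSet S)
    (hc : ∀ u, u ∈ S ↔ trunc c u ∈ S) (m : ℕ) :
    ∑ j ∈ range #((box S c).filter fun v => #(topFace c v) = D + 1),
      (if j ≤ m then (m - j + D).choose D else 0) ≤ levelCard S m := by
  set T := (box S c).filter fun v => #(topFace c v) = D + 1 with hT
  obtain ⟨e, he⟩ := exists_monotone_enumeration T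
    fun v => (v.filter (· ∉ topFace c v)).degree
  have heT : ∀ j, (e j : σ →₀ ℕ) ∈ box S c ∧ #(topFace c (e j : σ →₀ ℕ)) = D + 1 := fun j =>
    mem_filter.1 (e j).2
  refine sum_choose_le_levelCard (fun j => (e j : σ →₀ ℕ).filter (· ∉ topFace c (e j : σ →₀ ℕ)))
    (fun j => topFace c (e j : σ →₀ ℕ)) (fun j i hi => ?_) (fun j => ?_) (fun j => (heT j).2)
    (fun i j hZ ha => ?_) (fun j => ?_) m
  · exact Finsupp.filter_apply_neg (· ∉ topFace c (e j : σ →₀ ℕ)) _ (by simpa using hi)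
  · exact cone_filter_subset hS hc (mem_box.1 (heT j).1).1
  · refine e.injective (Subtype.ext (Finsupp.ext fun v => ?_))
    by_cases hv : v ∈ topFace c (e i : σ →₀ ℕ)
    · rw [mem_topFace.1 hv, mem_topFace.1 (hZ ▸ hv)]
    · have h := DFunLike.congr_fun ha v
      rwa [Finsupp.filter_apply_pos (· ∉ topFace c (e i : σ →₀ ℕ)) _ hv,
        Finsupp.filter_apply_pos (· ∉ topFace c (e j : σ →₀ ℕ)) _ (hZ ▸ hv)] at h
  -- Every `t` below the degree of the `j`-th vertex is the degree of a vertex with the same face,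
  -- placed earlier by the sorting. Distinct `t` give distinct indices.
  · have key : ∀ t : ℕ, ∃ i, t < ((e j : σ →₀ ℕ).filter
        (· ∉ topFace c (e j : σ →₀ ℕ))).degree → (i < j ∧
        topFace c (e i : σ →₀ ℕ) = topFace c (e j : σ →₀ ℕ)) ∧
        ((e i : σ →₀ ℕ).filter (· ∉ topFace c (e i : σ →₀ ℕ))).degree = t := by
      intro t
      by_cases ht : t < ((e j : σ →₀ ℕ).filter (· ∉ topFace c (e j : σ →₀ ℕ))).degree
      · obtain ⟨v, hv, hface, hdeg⟩ := exists_mem_box_degree_eq hS (heT j).1 ht.le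
        obtain ⟨i, hi⟩ := e.surjective ⟨v, mem_filter.2 ⟨hv, hface ▸ (heT j).2⟩⟩
        refine ⟨i, fun _ => ?_⟩
        rw [hi]
        refine ⟨⟨?_, hface⟩, hdeg⟩
        by_contra hij
        have := he (not_lt.1 hij)
        simp only [hi] at this
        omega
      · exact ⟨j, fun h => absurd h ht⟩
    choose f hf using key
    conv_lhs => rw [← card_range ((e j : σ →₀ ℕ).filter (· ∉ topFace c (e j : σ →₀ ℕ))).degree]
    refine card_le_card_of_injOn f (fun t ht => ?_) (fun t ht t' ht' h => ?_)
    · simpa using (hf t (by simpa using ht)).1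
    · rw [← (hf t (by simpa using ht)).2, ← (hf t' (by simpa using ht')).2, h]

end DisjointCones

end HilbertBound

namespace HilbertBound

/-! ### Standard monomials as a basis of the quotient -/

section StandardMonomials

open MvPolynomial

variable {k σ : Type*} [Field k] (m : MonomialOrder σ) (I : Ideal (MvPolynomial σ k))

/-- The exponents that are not leading exponents of nonzero elements of `I`. -/
def standardExponents : Set (σ →₀ ℕ) := {u | ∀ f ∈ I, f ≠ 0 → m.degree f ≠ u}

lemma isLowerSet_standardExponents : IsLowerSet (standardExponents m I) := by
  intro u v hvu hu f hf hf0 hfv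
  have hmon : (monomial (u - v) (1 : k)) ≠ 0 := by simp
  refine hu (monomial (u - v) 1 * f) (I.mul_mem_left _ hf) (mul_ne_zero hmon hf0) ?_
  classical
  rw [m.degree_mul hmon hf0, m.degree_monomial, if_neg one_ne_zero, hfv,
    tsub_add_cancel_of_le hvu]

variable {m I}

lemma eq_zero_of_support_subset_standardExponents {f : MvPolynomial σ k} (hf : f ∈ I)
    (h : (f.support : Set (σ →₀ ℕ)) ⊆ standardExponents m I) : f = 0 := by
  by_contra hf0
  exact h (m.degree_mem_support hf0) f hf hf0 rfl

/-- Division by well-founded induction on the monomial order, kept within one degree. -/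
lemma mk_monomial_mem (hI : ∀ f ∈ I, ∀ j, homogeneousComponent j f ∈ I) (u : σ →₀ ℕ) :
    Ideal.Quotient.mkₐ k I (monomial u 1) ∈
      (restrictSupport k (standardExponents m I ∩ {v | v.degree = u.degree})).map
        (Ideal.Quotient.mkₐ k I).toLinearMap := by
  classical
  induction h : m.toSyn u using WellFoundedLT.induction generalizing u with
  | ind s ih =>
    subst h
    by_cases hu : u ∈ standardExponents m I
    · refine Submodule.mem_map.2 ⟨monomial u 1, ?_, rfl⟩
      simp [hu]
    · simp only [standardExponents, Set.mem_ofPred_eq, not_forall, not_not] at hu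
      obtain ⟨f, hf, hf0, hfu⟩ := hu
      set a := coeff u f with ha
      have ha0 : a ≠ 0 := by
        rw [ha, ← hfu]
        exact m.coeff_degree_ne_zero_iff.2 hf0
      -- The order need not respect degree, so only the component of `f` in the degree of `u` is
      -- subtracted. It lies in `I` and still has leading exponent `u`.
      set q := monomial u 1 - a⁻¹ • homogeneousComponent u.degree f with hq
      have hmk : Ideal.Quotient.mkₐ k I (monomial u 1) = Ideal.Quotient.mkₐ k I q := by
        refine (Ideal.Quotient.eq.2 ?_ : Ideal.Quotient.mk I _ = Ideal.Quotient.mk I _)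
        rw [hq, sub_sub_cancel]
        exact Submodule.smul_of_tower_mem I _ (hI f hf _)
      have hsupp : ∀ v ∈ q.support, v.degree = u.degree ∧ m.toSyn v < m.toSyn u := by
        intro v hv
        have hvu : v ≠ u := by
          rintro rfl
          rw [MvPolynomial.mem_support_iff, hq, MvPolynomial.coeff_sub, MvPolynomial.coeff_smul, coeff_homogeneousComponent, if_pos rfl,
            MvPolynomial.coeff_monomial, if_pos rfl, smul_eq_mul, inv_mul_cancel₀ ha0, sub_self] at hv
          exact hv rfl
        rw [MvPolynomial.mem_support_iff, hq, MvPolynomial.coeff_sub, MvPolynomial.coeff_smul, coeff_homogeneousComponent,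
          MvPolynomial.coeff_monomial, if_neg hvu.symm, zero_sub, neg_ne_zero, smul_eq_mul] at hv
        have hdeg : v.degree = u.degree := by
          by_contra hne
          rw [if_neg hne, mul_zero] at hv
          exact hv rfl
        rw [if_pos hdeg] at hv
        refine ⟨hdeg, lt_of_le_of_ne ?_ (m.toSyn.injective.ne hvu)⟩
        rw [← hfu]
        exact m.le_degree (MvPolynomial.mem_support_iff.2 (right_ne_zero_of_mul hv))
      rw [hmk, q.as_sum, map_sum]
      refine Submodule.sum_mem _ fun v hv => ?_
      obtain ⟨hdeg, hlt⟩ := hsupp v hv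
      have hmem := ih _ hlt v rfl
      rw [hdeg] at hmem
      have : monomial v (coeff v q) = coeff v q • monomial v (1 : k) := by
        rw [MvPolynomial.smul_monomial, smul_eq_mul, mul_one]
      rw [this, map_smul]
      exact Submodule.smul_mem _ _ hmem

lemma map_restrictSupport_eq (hI : ∀ f ∈ I, ∀ j, homogeneousComponent j f ∈ I) (P : ℕ → Prop) :
    (restrictSupport k {u | P u.degree}).map (Ideal.Quotient.mkₐ k I).toLinearMap =
      (restrictSupport k {u | u ∈ standardExponents m I ∧ P u.degree}).map
        (Ideal.Quotient.mkₐ k I).toLinearMap := by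
  refine le_antisymm ?_ (Submodule.map_mono (restrictSupport_mono k fun u hu => hu.2))
  rw [restrictSupport_eq_span, Submodule.map_span_le]
  rintro _ ⟨u, hu, rfl⟩
  refine Submodule.map_mono (restrictSupport_mono k ?_) (mk_monomial_mem (m := m) hI u)
  rintro v ⟨hv, hvu⟩
  exact ⟨hv, by rw [hvu]; exact hu⟩

lemma finrank_restrictSupport (U : Set (σ →₀ ℕ)) :
    Module.finrank k (restrictSupport k U) = U.ncard := by
  rw [Module.finrank_eq_nat_card_basis (basisRestrictSupport k U)]
  rfl

lemma finrank_map_restrictSupport (hI : ∀ f ∈ I, ∀ j, homogeneousComponent j f ∈ I)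
    (P : ℕ → Prop) :
    Module.finrank k ((restrictSupport k {u | P u.degree}).map
      (Ideal.Quotient.mkₐ k I).toLinearMap) =
      {u | u ∈ standardExponents m I ∧ P u.degree}.ncard := by
  rw [map_restrictSupport_eq (m := m) hI, ← LinearMap.range_domRestrict,
    LinearMap.finrank_range_of_inj, finrank_restrictSupport]
  rw [← LinearMap.ker_eq_bot, LinearMap.ker_eq_bot']
  rintro ⟨f, hf⟩ hf0
  refine Subtype.ext (eq_zero_of_support_subset_standardExponents (m := m) (I := I) ?_ ?_)
  · exact Ideal.Quotient.eq_zero_iff_mem.1 hf0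
  · exact fun u hu => (mem_restrictSupport_iff k |>.1 hf hu).1

end StandardMonomials

lemma homogeneousComponent_mem {k : Type*} [Field k] {σ : Type*}
    {I : Ideal (MvPolynomial σ k)} (hI : I.IsHomogeneous (MvPolynomial.homogeneousSubmodule σ k))
    (f : MvPolynomial σ k) (hf : f ∈ I) (j : ℕ) : MvPolynomial.homogeneousComponent j f ∈ I := by
  have := hI j hf
  rwa [← MvPolynomial.decomposition.decompose'_apply]

lemma hilbertFunction_eq_levelCard {k : Type*} [Field k] {n : ℕ}
    {I : Ideal (MvPolynomial (Fin (n + 1)) k)}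
    (hI : I.IsHomogeneous (MvPolynomial.homogeneousSubmodule (Fin (n + 1)) k))
    (m : MonomialOrder (Fin (n + 1))) (j : ℕ) :
    hilbertFunction I j = levelCard (standardExponents m I) j := by
  rw [hilbertFunction, MvPolynomial.homogeneousSubmodule_eq_finsupp_supported]
  exact finrank_map_restrictSupport (homogeneousComponent_mem hI) (· = j)

end HilbertBound

namespace HilbertBound

/-! ### Krull dimension and Noether normalization -/

section Dimension

/-- Incomparability gives `≤`; lying over and going up give `≥`. -/
lemma ringKrullDim_eq_of_isIntegral {R S : Type*} [CommRing R] [CommRing S] [Algebra R S]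
    [Algebra.IsIntegral R S] (h : Function.Injective (algebraMap R S)) :
    ringKrullDim S = ringKrullDim R := by
  refine le_antisymm ?_ (iSup_le fun l => ?_)
  · refine Order.krullDim_le_of_strictMono (PrimeSpectrum.comap (algebraMap R S)) fun P Q hPQ => ?_
    exact Ideal.IsIntegral.comap_lt_comap (R := R) hPQ
  · obtain ⟨P, -, hP, hPl⟩ := Ideal.exists_ideal_over_prime_of_isIntegral
      (RelSeries.head l).asIdeal (⊥ : Ideal S) (by
        rw [Ideal.comap_bot_of_injective _ h]
        exact bot_le)
    have : P.LiesOver (RelSeries.head l).asIdeal := ⟨hPl.symm⟩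
    obtain ⟨L, hL, -⟩ := Ideal.exists_ltSeries_of_hasGoingUp l P
    rw [← hL]
    exact le_iSup (fun L : LTSeries (PrimeSpectrum S) => (L.length : WithBot ℕ∞)) L

lemma exists_finite_inj_algHom_of_ringKrullDim_eq {k A : Type*} [Field k] [CommRing A]
    [Algebra k A] [Algebra.FiniteType k A] {r : ℕ} (hr : ringKrullDim A = r) :
    ∃ g : MvPolynomial (Fin r) k →ₐ[k] A, Function.Injective g ∧ g.Finite := by
  have : Nontrivial A := by
    by_contra h
    rw [not_nontrivial_iff_subsingleton] at h
    rw [ringKrullDim_eq_bot_of_subsingleton] at hr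
    exact absurd hr (WithBot.bot_ne_coe (a := (r : ℕ∞)))
  obtain ⟨s, g, hg, hfin⟩ := exists_finite_inj_algHom_of_fg k A
  suffices s = r by subst this; exact ⟨g, hg, hfin⟩
  let := g.toRingHom.toAlgebra
  have : Module.Finite (MvPolynomial (Fin s) k) A := hfin
  have h := ringKrullDim_eq_of_isIntegral (R := MvPolynomial (Fin s) k) (S := A) hg
  rw [hr, MvPolynomial.ringKrullDim_of_isNoetherianRing, ringKrullDim_eq_zero_of_field, zero_add,
    Nat.card_fin] at h
  exact_mod_cast h.symm

end Dimension

/-! ### Growth of the quotient and of cones -/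

section Growth

open MvPolynomial

variable {k σ : Type*} [Field k]

lemma ncard_setOf_forall_le [Finite σ] (N : ℕ) :
    {u : σ →₀ ℕ | ∀ i, u i ≤ N}.ncard = (N + 1) ^ Nat.card σ := by
  have := Fintype.ofFinite σ
  let e : {u : σ →₀ ℕ | ∀ i, u i ≤ N} ≃ (σ → {x : ℕ // x ≤ N}) :=
    (Finsupp.equivFunOnFinite.subtypeEquiv fun u => Iff.rfl).trans
      (Equiv.subtypePiEquivPi (p := fun _ x => x ≤ N))
  have hN : Nat.card {x : ℕ // x ≤ N} = N + 1 := by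
    have := Set.ncard_Iic_nat N
    exact this
  rw [← Nat.card_coe_set_eq, Nat.card_congr e, Nat.card_pi, Finset.prod_const, hN,
    Finset.card_univ, Nat.card_eq_fintype_card]

lemma finrank_restrictDegree [Finite σ] (N : ℕ) :
    Module.finrank k (restrictDegree σ k N) = (N + 1) ^ Nat.card σ := by
  rw [restrictDegree, finrank_restrictSupport, ncard_setOf_forall_le]

instance finite_restrictDegree [Finite σ] (N : ℕ) : Module.Finite k (restrictDegree σ k N) :=
  Module.finite_of_finrank_pos (by rw [finrank_restrictDegree]; positivity)

lemma finite_restrictTotalDegree [Finite σ] (N : ℕ) :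
    Module.Finite k (restrictTotalDegree σ k N) :=
  have : Finite {u : σ →₀ ℕ | (u.sum fun _ e => e) ≤ N} := finite_setOf_degree_le N
  Module.Finite.of_basis (basisRestrictSupport k _)

variable {A : Type*} [CommRing A] [Algebra k A]

/-- Lift the images of the `r` variables to polynomials `q i`. Monomials with exponents at most `t`
then lift to total degree at most `(∑ deg q i) * t`. -/
lemma exists_pow_le_finrank [Finite σ] {r : ℕ} (φ : MvPolynomial σ k →ₐ[k] A)
    (hφ : Function.Surjective φ) (g : MvPolynomial (Fin r) k →ₐ[k] A)
    (hg : Function.Injective g) :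
    ∃ a, ∀ t, (t + 1) ^ r ≤
      Module.finrank k ((restrictTotalDegree σ k (a * t)).map φ.toLinearMap) := by
  choose q hq using fun i => hφ (g (MvPolynomial.X i))
  refine ⟨∑ i, (q i).totalDegree, fun t => ?_⟩
  have := finite_restrictTotalDegree (k := k) (σ := σ) ((∑ i, (q i).totalDegree) * t)
  have hcard := finrank_restrictDegree (k := k) (σ := Fin r) t
  rw [Nat.card_fin] at hcard
  rw [← hcard, (Submodule.equivMapOfInjective g.toLinearMap hg _).finrank_eq]
  refine Submodule.finrank_mono ?_
  rw [restrictDegree, restrictSupport_eq_span, Submodule.map_span_le]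
  rintro _ ⟨u, hu, rfl⟩
  refine Submodule.mem_map.2 ⟨∏ i, q i ^ u i, ?_, ?_⟩
  · rw [mem_restrictTotalDegree, Finset.sum_mul]
    refine (totalDegree_finsetProd _ _).trans (Finset.sum_le_sum fun i _ => ?_)
    refine (totalDegree_pow _ _).trans ?_
    rw [mul_comm]
    exact Nat.mul_le_mul_left _ (hu i)
  · simp only [AlgHom.toLinearMap_apply, map_prod, map_pow, hq]
    rw [monomial_eq, MvPolynomial.C_1, one_mul, Finsupp.prod_fintype _ _ (by simp)]
    simp

lemma restrictDegree_mono {N N' : ℕ} (h : N ≤ N') :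
    restrictDegree σ k N ≤ restrictDegree σ k N' :=
  restrictSupport_mono k fun _ hu i => (hu i).trans h

lemma mul_mem_restrictDegree {p q : MvPolynomial σ k} {N N' : ℕ} (hp : p ∈ restrictDegree σ k N)
    (hq : q ∈ restrictDegree σ k N') : p * q ∈ restrictDegree σ k (N + N') := by
  classical
  rw [mem_restrictDegree] at *
  intro u hu i
  obtain ⟨v, hv, w, hw, rfl⟩ := Finset.mem_add.1 (support_mul p q hu)
  exact add_le_add (hp v hv i) (hq w hw i)

lemma mem_restrictDegree_totalDegree (p : MvPolynomial σ k) :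
    p ∈ restrictDegree σ k p.totalDegree :=
  restrictTotalDegree_le_restrictDegree σ k _ ((mem_restrictTotalDegree σ _ p).2 le_rfl)

/-- With finitely many module generators `w l`, multiplication by one variable raises the degrees of
the coefficients by a bounded amount. -/
lemma exists_finrank_le_pow [Finite σ] {r : ℕ} (φ : MvPolynomial σ k →ₐ[k] A)
    (g : MvPolynomial (Fin r) k →ₐ[k] A) (hg : g.Finite) :
    ∃ s e, ∀ M, Module.finrank k ((restrictTotalDegree σ k M).map φ.toLinearMap) ≤
      s * (e * (M + 1) + 1) ^ r := by
  have := Fintype.ofFinite σ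
  let := g.toRingHom.toAlgebra
  have : Module.Finite (MvPolynomial (Fin r) k) A := hg
  have : IsScalarTower k (MvPolynomial (Fin r) k) A :=
    IsScalarTower.of_algebraMap_eq fun x => (g.commutes x).symm
  obtain ⟨s, w, hw⟩ := Module.Finite.exists_fin (R := MvPolynomial (Fin r) k) (M := A)
  have hw' : ∀ x : A, ∃ c : Fin s → MvPolynomial (Fin r) k, ∑ l, c l • w l = x := fun x => by
    rw [← Submodule.mem_span_range_iff_exists_fun, hw]
    trivial
  choose c hc using hw'
  -- `e` dominates the coefficients of `1` and of every `x_i * w l`, hence both the start and each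
  -- step of the induction on degree.
  let e := ∑ l, (c 1 l).totalDegree + ∑ i, ∑ l, ∑ l', (c (φ (MvPolynomial.X i) * w l) l').totalDegree
  have he1 : ∀ l, c 1 l ∈ restrictDegree (Fin r) k e := fun l =>
    restrictDegree_mono (le_add_right (Finset.single_le_sum (f := fun l => (c 1 l).totalDegree)
      (fun _ _ => Nat.zero_le _) (Finset.mem_univ l))) (mem_restrictDegree_totalDegree _)
  have he2 : ∀ i l l', c (φ (MvPolynomial.X i) * w l) l' ∈ restrictDegree (Fin r) k e := fun i l l' => by
    refine restrictDegree_mono (le_add_left ?_) (mem_restrictDegree_totalDegree _)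
    refine le_trans ?_ (Finset.single_le_sum
      (f := fun i => ∑ l, ∑ l', (c (φ (MvPolynomial.X i) * w l) l').totalDegree)
      (fun _ _ => Nat.zero_le _) (Finset.mem_univ i))
    refine le_trans ?_ (Finset.single_le_sum
      (f := fun l => ∑ l', (c (φ (MvPolynomial.X i) * w l) l').totalDegree)
      (fun _ _ => Nat.zero_le _) (Finset.mem_univ l))
    exact Finset.single_le_sum (f := fun l' => (c (φ (MvPolynomial.X i) * w l) l').totalDegree)
      (fun _ _ => Nat.zero_le _) (Finset.mem_univ l')
  let L : ∀ N, (Fin s → restrictDegree (Fin r) k N) →ₗ[k] A := fun N =>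
    ∑ l, ((LinearMap.toSpanSingleton (MvPolynomial (Fin r) k) A (w l)).restrictScalars k ∘ₗ
      (restrictDegree (Fin r) k N).subtype ∘ₗ LinearMap.proj l)
  have hL : ∀ N x, x ∈ LinearMap.range (L N) ↔ ∃ p : Fin s → MvPolynomial (Fin r) k,
      (∀ l, p l ∈ restrictDegree (Fin r) k N) ∧ ∑ l, p l • w l = x := by
    intro N x
    constructor
    · rintro ⟨p, rfl⟩
      exact ⟨fun l => p l, fun l => (p l).2, by simp [L]⟩
    · rintro ⟨p, hp, rfl⟩
      exact ⟨fun l => ⟨p l, hp l⟩, by simp [L]⟩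
  have hX : ∀ i N x, x ∈ LinearMap.range (L N) → φ (MvPolynomial.X i) * x ∈ LinearMap.range (L (N + e)) := by
    intro i N x hx
    obtain ⟨p, hp, rfl⟩ := (hL _ _).1 hx
    refine (hL _ _).2 ⟨fun l' => ∑ l, p l * c (φ (MvPolynomial.X i) * w l) l', fun l' =>
      Submodule.sum_mem _ fun l _ => mul_mem_restrictDegree (hp l) (he2 i l l'), ?_⟩
    simp only [Finset.sum_smul, mul_smul]
    rw [Finset.sum_comm, Finset.mul_sum]
    refine Finset.sum_congr rfl fun l _ => ?_
    rw [← Finset.smul_sum, hc, mul_smul_comm]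
  have hmono : ∀ {N N'}, N ≤ N' → LinearMap.range (L N) ≤ LinearMap.range (L N') := by
    intro N N' h x hx
    obtain ⟨p, hp, rfl⟩ := (hL _ _).1 hx
    exact (hL _ _).2 ⟨p, fun l => restrictDegree_mono h (hp l), rfl⟩
  have hmon : ∀ M, ∀ u : σ →₀ ℕ, u.degree = M →
      φ (monomial u 1) ∈ LinearMap.range (L (e * (M + 1))) := by
    intro M
    induction M with
    | zero =>
      intro u hu
      rw [(Finsupp.degree_eq_zero_iff u).1 hu, MvPolynomial.monomial_zero', MvPolynomial.C_1, map_one]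
      exact (hL _ _).2 ⟨c 1, by simpa using he1, hc 1⟩
    | succ M ih =>
      intro u hu
      have hu0 : u ≠ 0 := by rintro rfl; simp at hu
      obtain ⟨i, hi⟩ := Finsupp.ne_iff.1 hu0
      have hle : Finsupp.single i 1 ≤ u := by
        rw [Finsupp.single_le_iff]
        exact Nat.one_le_iff_ne_zero.2 hi
      have hadd := add_tsub_cancel_of_le hle
      have hdeg := congrArg Finsupp.degree hadd
      rw [map_add, Finsupp.degree_single] at hdeg
      have hprod : MvPolynomial.monomial u (1 : k) = MvPolynomial.X i * MvPolynomial.monomial (u - Finsupp.single i 1) 1 := by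
        rw [MvPolynomial.X, MvPolynomial.monomial_mul, hadd, one_mul]
      rw [hprod, map_mul, mul_add e (M + 1) 1, mul_one]
      exact hX i _ _ (ih _ (by omega))
  refine ⟨s, e, fun M => ?_⟩
  calc Module.finrank k ((restrictTotalDegree σ k M).map φ.toLinearMap)
      ≤ Module.finrank k (LinearMap.range (L (e * (M + 1)))) := by
        refine Submodule.finrank_mono ?_
        rw [restrictTotalDegree, restrictSupport_eq_span, Submodule.map_span_le]
        rintro _ ⟨u, hu, rfl⟩
        refine hmono (Nat.mul_le_mul_left e (Nat.add_le_add_right ?_ 1)) (hmon u.degree u rfl)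
        exact hu
    _ ≤ Module.finrank k (Fin s → restrictDegree (Fin r) k (e * (M + 1))) :=
        LinearMap.finrank_range_le _
    _ = s * (e * (M + 1) + 1) ^ r := by
        rw [Module.finrank_pi_fintype]
        simp only [finrank_restrictDegree, Nat.card_fin, Finset.sum_const, Finset.card_univ,
          Fintype.card_fin, smul_eq_mul]

lemma le_of_forall_pow_le {a b K : ℕ} (h : ∀ t : ℕ, (t + 1) ^ a ≤ K * (t + 1) ^ b) : a ≤ b := by
  by_contra! hab
  have h1 := h K
  have h2 : (K + 1) ^ (b + 1) ≤ (K + 1) ^ a := Nat.pow_le_pow_right (by omega) hab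
  have h3 : K * (K + 1) ^ b < (K + 1) ^ (b + 1) := by
    rw [pow_succ']
    exact Nat.mul_lt_mul_of_pos_right (by omega) (by positivity)
  omega

lemma ncard_cone_degree_le (g : σ →₀ ℕ) (Z : Finset σ) (M : ℕ) :
    {u | u ∈ cone g Z ∧ u.degree ≤ M}.ncard ≤ (M + 1) ^ Z.card := by
  let f : {u | u ∈ cone g Z ∧ u.degree ≤ M} → (Z → Fin (M + 1)) := fun u i =>
    ⟨u.1 i, Nat.lt_succ_of_le ((apply_le_degree u.1 i).trans u.2.2)⟩
  have hf : Function.Injective f := by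
    intro u v huv
    refine Subtype.ext (Finsupp.ext fun i => ?_)
    by_cases hi : i ∈ Z
    · exact congrArg Fin.val (congrFun huv ⟨i, hi⟩)
    · rw [u.2.1.2 i hi, v.2.1.2 i hi]
  rw [← Nat.card_coe_set_eq]
  refine (Nat.card_le_card_of_injective f hf).trans_eq ?_
  rw [Nat.card_fun, Nat.card_fin, Nat.card_eq_fintype_card, Fintype.card_coe]

lemma pow_le_ncard_degree_le [Finite σ] {S : Set (σ →₀ ℕ)} {Z : Finset σ}
    (hS : ∀ u : σ →₀ ℕ, u.support ⊆ Z → u ∈ S) (t : ℕ) :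
    (t + 1) ^ Z.card ≤ {u | u ∈ S ∧ u.degree ≤ Z.card * t}.ncard := by
  classical
  let f : (Z → Fin (t + 1)) → {u | u ∈ S ∧ u.degree ≤ Z.card * t} := fun x =>
    ⟨Finsupp.onFinset Z (fun i => if h : i ∈ Z then (x ⟨i, h⟩ : ℕ) else 0)
      fun i hi => by by_contra h; simp [h] at hi,
    hS _ Finsupp.support_onFinset_subset, by
      rw [Finsupp.degree_apply]
      refine (Finset.sum_le_sum_of_subset Finsupp.support_onFinset_subset).trans ?_
      refine (Finset.sum_le_card_nsmul _ _ t fun i hi => ?_).trans_eq (smul_eq_mul _ _)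
      rw [Finsupp.onFinset_apply, dif_pos hi]
      exact Nat.le_of_lt_succ (x ⟨i, hi⟩).2⟩
  have hf : Function.Injective f := by
    intro x y hxy
    funext i
    have := DFunLike.congr_fun (congrArg Subtype.val hxy) i.1
    simp only [f, Finsupp.onFinset_apply, i.2, dif_pos] at this
    exact Fin.ext this
  have : Finite {u | u ∈ S ∧ u.degree ≤ Z.card * t} :=
    (finite_setOf_degree_le (Z.card * t)).subset fun u hu => hu.2
  rw [← Nat.card_coe_set_eq]
  refine le_trans (Eq.ge ?_) (Nat.card_le_card_of_injective f hf)
  rw [Nat.card_fun, Nat.card_fin, Nat.card_eq_fintype_card, Fintype.card_coe]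

end Growth

end HilbertBound

namespace HilbertBound

/-! ### Hilbert polynomial and dimension of the cones -/

section HilbertPolynomial

open Finset

lemma binom_sub_binom (m d δ : ℕ) :
    binom ((m : ℤ) + d + 1) (d + 1) - binom ((m : ℤ) - δ + d + 1) (d + 1) =
      ((∑ j ∈ range δ, if j ≤ m then (m - j + d).choose d else 0 : ℕ) : ℤ) := by
  induction δ with
  | zero => simp
  | succ δ ih =>
    rw [sum_range_succ, Nat.cast_add _ (ite _ _ _), ← ih]
    suffices h : binom ((m : ℤ) - δ + d + 1) (d + 1) =
        binom ((m : ℤ) - (δ + 1 : ℕ) + d + 1) (d + 1) +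
          ((if δ ≤ m then (m - δ + d).choose d else 0 : ℕ) : ℤ) by
      rw [h]; ring
    by_cases hδ : δ ≤ m
    · have h1 : (m : ℤ) - δ + d + 1 = (m - δ + d + 1 : ℕ) := by omega
      have h2 : (m : ℤ) - (δ + 1 : ℕ) + d + 1 = (m - δ + d : ℕ) := by omega
      rw [h1, h2, if_pos hδ, binom, binom, if_pos (by positivity), if_pos (by positivity),
        Int.toNat_natCast, Int.toNat_natCast, Nat.choose_succ_succ, Nat.cast_add, add_comm]
    -- For `δ > m` both upper entries are below `d + 1`, possibly negative, where `binom` is `0`.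
    · have hzero : ∀ a : ℤ, a < d + 1 → binom a (d + 1) = 0 := by
        intro a ha
        rw [binom]
        split_ifs with h
        · rw [Nat.choose_eq_zero_of_lt (by omega), Nat.cast_zero]
        · rfl
      rw [if_neg hδ, hzero _ (by omega), hzero _ (by omega)]
      simp

variable {k : Type*} [Field k] {n : ℕ} {I : Ideal (MvPolynomial (Fin (n + 1)) k)}

lemma IsHilbertPolynomial.unique {p q : ℚ[X]} (hp : IsHilbertPolynomial I p)
    (hq : IsHilbertPolynomial I q) : p = q := by
  obtain ⟨a, ha⟩ := hp
  obtain ⟨b, hb⟩ := hq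
  refine eq_of_infinite_eval_eq p q ?_
  refine ((Set.infinite_of_injective_forall_mem (f := fun t : ℕ => ((t + a + b : ℕ) : ℚ))
    fun s t h => ?_) fun t => ?_)
  · have : s + a + b = t + a + b := Nat.cast_injective (R := ℚ) h
    omega
  · simp only [Set.mem_ofPred_eq]
    rw [← ha _ (by omega), ← hb _ (by omega)]

lemma IsHilbertPolynomial.hilbertPolynomial_eq {p : ℚ[X]} (hp : IsHilbertPolynomial I p) :
    hilbertPolynomial I = p := by
  have h : ∃ p : ℚ[X], IsHilbertPolynomial I p := ⟨p, hp⟩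
  rw [hilbertPolynomial, dif_pos h]
  exact h.choose_spec.unique hp

/-- The Krull dimension of `k[x]/I` is the largest dimension of a coordinate cone of standard
monomials of `I`. -/
lemma sup_card_topFace_eq (hI : I.IsHomogeneous (MvPolynomial.homogeneousSubmodule _ k))
    {r : ℕ} (hr : ringKrullDim (MvPolynomial (Fin (n + 1)) k ⧸ I) = r)
    (m : MonomialOrder (Fin (n + 1))) {c : ℕ}
    (hc : ∀ u, u ∈ standardExponents m I ↔ trunc c u ∈ standardExponents m I) :
    ((box (standardExponents m I) c).sup fun v => #(topFace c v)) = r := by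
  set S := standardExponents m I with hSdef
  set E := (box S c).sup fun v => #(topFace c v) with hE
  have hS : IsLowerSet S := isLowerSet_standardExponents m I
  have hfinrank : ∀ M, Module.finrank k
      ((MvPolynomial.restrictTotalDegree (Fin (n + 1)) k M).map
        (Ideal.Quotient.mkₐ k I).toLinearMap) = {u | u ∈ S ∧ u.degree ≤ M}.ncard := fun M =>
    finrank_map_restrictSupport (homogeneousComponent_mem hI) (· ≤ M)
  obtain ⟨g, hg, hgfin⟩ := exists_finite_inj_algHom_of_ringKrullDim_eq (k := k) hr
  have hsurj : Function.Surjective (Ideal.Quotient.mkₐ k I) := Ideal.Quotient.mkₐ_surjective k I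
  refine le_antisymm ?_ ?_
  -- `S` contains the whole coordinate face `ℕ^(topFace c v)`, whose growth exponent is its
  -- dimension; the quotient grows with exponent at most `r`.
  · obtain ⟨s, e, hse⟩ := exists_finrank_le_pow (Ideal.Quotient.mkₐ k I) g hgfin
    simp only [hfinrank] at hse
    refine Finset.sup_le fun v hv => ?_
    have hface : ∀ u : Fin (n + 1) →₀ ℕ, u.support ⊆ topFace c v → u ∈ S := by
      intro u hu
      rw [hc]
      refine hS (fun i => ?_) (mem_box.1 hv).1
      rw [trunc_apply]
      by_cases hi : i ∈ topFace c v
      · exact (min_le_right _ _).trans_eq (mem_topFace.1 hi).symm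
      · rw [Finsupp.notMem_support_iff.1 fun h => hi (hu h), Nat.zero_min]
        exact Nat.zero_le _
    set z := #(topFace c v)
    refine le_of_forall_pow_le (K := s * (e * (z + 1) + 1) ^ r) fun t => ?_
    refine (pow_le_ncard_degree_le hface t).trans ((hse _).trans ?_)
    rw [mul_assoc, ← mul_pow]
    refine Nat.mul_le_mul_left _ (Nat.pow_le_pow_left ?_ r)
    nlinarith [Nat.zero_le (e * t), Nat.zero_le (e * z), Nat.zero_le t]
  -- Conversely, finitely many cones of dimension at most `E` grow with exponent at most `E`, and
  -- the quotient with exponent at least `r`.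
  · obtain ⟨a, ha⟩ := exists_pow_le_finrank _ hsurj g hg
    simp only [hfinrank] at ha
    refine le_of_forall_pow_le (K := #(box S c) * (a + 1) ^ E) fun t => (ha t).trans ?_
    rw [ncard_eq_sum_cone hc _ (finite_setOf_degree_le _), mul_assoc, ← mul_pow]
    refine sum_le_card_nsmul _ _ _ fun v hv => (ncard_cone_degree_le _ _ _).trans ?_
    refine (Nat.pow_le_pow_right (Nat.succ_pos _) (hE ▸ Finset.le_sup
      (f := fun v => #(topFace c v)) hv)).trans (Nat.pow_le_pow_left ?_ E)
    nlinarith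

end HilbertPolynomial

end HilbertBound

/-! ### The main theorem -/

open HilbertBound in
theorem theorem2p3 {k : Type*} [Field k] (n d : ℕ)
    (I : Ideal (MvPolynomial (Fin (n + 1)) k))
    (hI : I.IsHomogeneous (MvPolynomial.homogeneousSubmodule (Fin (n + 1)) k))
    (hd : HilbertBound.HasProjDim I d) :
    HilbertBound.IsHilbertPolynomial I (HilbertBound.hilbertPolynomial I) ∧
    (HilbertBound.hilbertPolynomial I).degree = (d : WithBot ℕ) ∧
    ∃ δ : ℕ, HilbertBound.idealDegree I d = (δ : ℚ) ∧
      ∀ m : ℕ, 1 ≤ m →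
        HilbertBound.binom ((m : ℤ) + d + 1) (d + 1)
            - HilbertBound.binom ((m : ℤ) - δ + d + 1) (d + 1)
          ≤ (HilbertBound.hilbertFunction I m : ℤ) := by
  let o : MonomialOrder (Fin (n + 1)) := MonomialOrder.lex
  set S := standardExponents o I with hSdef
  have hS : IsLowerSet S := isLowerSet_standardExponents o I
  obtain ⟨c, hc⟩ := exists_mem_iff_trunc_mem hS
  have hr : ringKrullDim (MvPolynomial (Fin (n + 1)) k ⧸ I) = (d + 1 : ℕ) := by
    rw [HasProjDim] at hd
    exact_mod_cast hd
  have hsup := sup_card_topFace_eq hI hr o hc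
  have hle : ∀ v ∈ box S c, (topFace c v).card ≤ d + 1 := fun v hv =>
    hsup ▸ Finset.le_sup (f := fun v => (topFace c v).card) hv
  set T := (box S c).filter fun v => (topFace c v).card = d + 1 with hT
  -- An empty box would have supremum `0 ≠ d + 1`, so the maximum is attained and the leading
  -- coefficient is nonzero.
  have hTpos : T.card ≠ 0 := by
    have hne : (box S c).Nonempty := by
      rw [Finset.nonempty_iff_ne_empty]
      intro h
      rw [h] at hsup
      simp at hsup
    obtain ⟨v, hv, hv'⟩ := Finset.exists_mem_eq_sup _ hne fun v => (topFace c v).card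
    exact Finset.card_ne_zero_of_mem (Finset.mem_filter.2 ⟨hv, hv'.symm.trans hsup⟩)
  obtain ⟨p, hp, hdeg, hcoeff⟩ := exists_polynomial_eq_levelCard hc hle
  have hpI : IsHilbertPolynomial I p := by
    obtain ⟨m₀, hm₀⟩ := hp
    exact ⟨m₀, fun m hm => by rw [hilbertFunction_eq_levelCard hI o, hm₀ m hm]⟩
  have hfac : (d.factorial : ℚ) ≠ 0 := by exact_mod_cast d.factorial_ne_zero
  rw [hpI.hilbertPolynomial_eq]
  refine ⟨hpI, ?_, T.card, ?_, fun m _ => ?_⟩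
  · refine degree_eq_of_le_of_coeff_ne_zero (natDegree_le_iff_degree_le.1 hdeg) ?_
    rw [hcoeff]
    exact mul_ne_zero (by exact_mod_cast hTpos) (inv_ne_zero hfac)
  · rw [idealDegree, hpI.hilbertPolynomial_eq, hcoeff, mul_comm, mul_assoc,
      inv_mul_cancel₀ hfac, mul_one]
  · rw [binom_sub_binom, hilbertFunction_eq_levelCard hI o]
    exact_mod_cast sum_choose_le_levelCard_of_isLowerSet hS hc m
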